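/- Let $\mathfrak K$ be a field and let $\Lambda$ be a finite-dimensional $\mathfrak K$-algebra with Jacobson radical $J$. A module is called uniserial if it has exactly one composition series. Let $m\ge 2$ and suppose that $\Lambda$ is left $m$-multiserial, i.e. for every primitive idempotent $e$ of $\Lambda$ the left ideal $Je$ is a (not necessarily direct) sum of $m$ uniserial submodules, where zero submodules are allowed. Let $U$ be a finitely generated non-projective uniserial left $\Lambda$-module, and let $\alpha(U)$ denote the number of indecomposable direct summands in a decomposition into indecomposables of the middle term $B$ of the almost split sequence $0\to A\to B\to U\to 0$ of finitely generated left $\Lambda$-modules. Then $\alpha(U)\le m$. That is, for every almost split sequence $0\to A\to B\to U\to 0$ ending in $U$ and every decomposition $B=B_1\oplus\dots\oplus B_n$ with all $B_i$ indecomposable, one has $n\le m$. -/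

import Mathlib

universe u

/-- A module is uniserial if it has exactly one composition series. -/
def IsUniserialModule (R M : Type*) [Ring R] [AddCommGroup M] [Module R M] : Prop :=
  ∃! s : CompositionSeries (Submodule R M), s.head = ⊥ ∧ s.last = ⊤

/-- A module is indecomposable if it is nonzero and is not the direct sum of two nonzero
submodules. -/
def IsIndecomposableModule (R M : Type*) [Ring R] [AddCommGroup M] [Module R M] : Prop :=
  Nontrivial M ∧ ∀ N N' : Submodule R M, IsCompl N N' → N = ⊥ ∨ N' = ⊥

/-- A primitive idempotent: a nonzero idempotent that is not the sum of two nonzero orthogonal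
idempotents. -/
def IsPrimitiveIdempotent {R : Type*} [Ring R] (e : R) : Prop :=
  e ≠ 0 ∧ IsIdempotentElem e ∧
    ∀ f g : R, IsIdempotentElem f → IsIdempotentElem g → f * g = 0 → g * f = 0 →
      e = f + g → f = 0 ∨ g = 0

/-- The left ideal `J e = {x * e | x ∈ J}`, where `J` is the Jacobson radical of `R`. -/
def radicalMul {R : Type*} [Ring R] (e : R) : Submodule R R :=
  Submodule.map (LinearMap.toSpanSingleton R R e) (Ring.jacobson R)

/-- `R` is left `m`-multiserial: for each primitive idempotent `e`, the left ideal `J e` is a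
(not necessarily direct) sum of `m` uniserial submodules. As the zero module is uniserial, this
is the same as a sum of at most `m` nonzero uniserial submodules. -/
def IsLeftMultiserial (m : ℕ) (R : Type*) [Ring R] : Prop :=
  ∀ e : R, IsPrimitiveIdempotent e →
    ∃ V : Fin m → Submodule R R, (∀ i, IsUniserialModule R (V i)) ∧ ⨆ i, V i = radicalMul e

/-- `g : B → C` is right almost split in the category of finitely generated left `R`-modules:
it is not a split epimorphism, and each map `X → C` that is not a split epimorphism factors
through `g`. (Each finitely generated `R`-module has an isomorphic copy in the universe of `R`.) -/
def IsRightAlmostSplit {R B C : Type u} [Ring R] [AddCommGroup B] [Module R B]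
    [AddCommGroup C] [Module R C] (g : B →ₗ[R] C) : Prop :=
  (¬ ∃ s : C →ₗ[R] B, g ∘ₗ s = LinearMap.id) ∧
    ∀ (X : Type u) [AddCommGroup X] [Module R X] [Module.Finite R X] (h : X →ₗ[R] C),
      (¬ ∃ s : C →ₗ[R] X, h ∘ₗ s = LinearMap.id) → ∃ k : X →ₗ[R] B, g ∘ₗ k = h

/-- `f : A → B` is left almost split in the category of finitely generated left `R`-modules:
it is not a split monomorphism, and each map `A → X` that is not a split monomorphism factors
through `f`. -/
def IsLeftAlmostSplit {R A B : Type u} [Ring R] [AddCommGroup A] [Module R A]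
    [AddCommGroup B] [Module R B] (f : A →ₗ[R] B) : Prop :=
  (¬ ∃ r : B →ₗ[R] A, r ∘ₗ f = LinearMap.id) ∧
    ∀ (X : Type u) [AddCommGroup X] [Module R X] [Module.Finite R X] (h : A →ₗ[R] X),
      (¬ ∃ r : X →ₗ[R] A, r ∘ₗ h = LinearMap.id) → ∃ k : B →ₗ[R] X, k ∘ₗ f = h

/-- `0 → A → B → C → 0` is an almost split sequence of left `R`-modules (to be used for finitely
generated `A`, `B`, `C`): it is exact, `f` is left almost split and `g` is right almost split. -/
structure IsAlmostSplitSequence {R A B C : Type u} [Ring R] [AddCommGroup A] [Module R A]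
    [AddCommGroup B] [Module R B] [AddCommGroup C] [Module R C]
    (f : A →ₗ[R] B) (g : B →ₗ[R] C) : Prop where
  injective : Function.Injective f
  exact : Function.Exact f g
  surjective : Function.Surjective g
  left_almost_split : IsLeftAlmostSplit f
  right_almost_split : IsRightAlmostSplit g

/-!
Let `P = Λe` be the projective cover of `U`, with kernel `V` and radical `J = ⨆ i, W i`, where the
`W i` are uniserial. The class of an almost split sequence in `Ext¹(U, A)`, a quotient of
`Hom(V, A)`, is nonzero and factors through every nonzero map `S → A` with `S` simple. A functional
that does not vanish on this class therefore turns composition into a pairing of `Hom(S, A)` and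
`Hom(V, S)` that is nondegenerate on the left. So `dim Hom(S, A) ≤ dim Hom(V, S)`, and
`dim Hom(S, B) ≤ dim Hom(V, S) + dim Hom(S, U)`.

Since `U` is uniserial, some `W i₀` satisfies `V ⊔ W i₀ = J`. Hence `V ⧸ V ⊓ W i₀` is a sum of
quotients of the other `W i`, and `dim Hom(V, S)` is at most a sum of `m` terms `dim Hom(X, S)` with
`X` uniserial. Each such `X`, like `U` in the last term above, contributes to one isomorphism type
of `S` only, and at most `dim End S` to it, so `B` contains at most `m + 1` independent simple
submodules.

One summand is saved as follows. If `U` is simple, then `Hom(S, A) = Hom(S, B)` and the term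
`dim Hom(S, U)` disappears. If `V ≤ W i₀`, then `V` and `U` are both uniserial and the bound is
`2 ≤ m`. Otherwise choose a maximal submodule `X` of `V` containing `V ⊓ W i₀`: comparing lengths,
a lift of `P ⧸ X → U` to `B` embeds `P ⧸ X` into one of the summands, where the images of `V` and
`W i₀` are independent and nonzero. That summand then counts twice in the bound `m + 1`.
-/

open scoped Finset

section Combinatorics

theorem iSupIndep_option {α ι : Type*} [CompleteLattice α] [IsModularLattice α] [Finite ι]
    {f : Option ι → α} (hf : iSupIndep fun i => f (some i))
    (hd : Disjoint (f none) (⨆ i, f (some i))) : iSupIndep f := by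
  classical
  have := Fintype.ofFinite ι
  rw [iSupIndep_iff_supIndep_univ] at hf ⊢
  have huniv : (Finset.univ : Finset (Option ι)) =
      insert none (Finset.univ.map Function.Embedding.some) := by
    ext o; cases o <;> simp
  rw [huniv]
  refine Finset.SupIndep.insert (Finset.supIndep_map.2 hf) ?_
  rwa [Finset.sup_map, Finset.sup_univ_eq_iSup]

theorem iSupIndep_option_elim_update {α ι : Type*} [CompleteLattice α] [IsModularLattice α]
    [Finite ι] [DecidableEq ι] {f : ι → α} (hf : iSupIndep f) {i : ι} {a b : α} (ha : a ≤ f i)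
    (hb : b ≤ f i) (hab : Disjoint a b) :
    iSupIndep fun o : Option ι => o.elim a (Function.update f i b) := by
  refine iSupIndep_option (hf.mono (update_le_self_iff.2 hb)) ?_
  have iSup_update : ⨆ j, Function.update f i b j = b ⊔ ⨆ (j) (_ : j ≠ i), f j := by
    rw [iSup_split_single _ i, Function.update_self]
    congr! 4 with j hj
    exact Function.update_of_ne hj _ _
  exact iSup_update ▸ hab.disjoint_sup_right_of_disjoint_sup_left
    ((hf i).mono_left (sup_le ha hb))

/- Applied with `κ` indexing simple submodules up to isomorphism `s`, `d k` the dimension of the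
endomorphisms of the `k`-th one, and `δ k i` the dimension of its space of maps to or from the
`i`-th of a family of modules. -/
theorem card_le_card_of_forall_card_mul_le_sum {κ ι : Type*} [Fintype κ] [Fintype ι]
    (s : Setoid κ) (d : κ → ℕ) (δ : κ → ι → ℕ) (hd : ∀ k, 0 < d k) (hδ : ∀ k i, δ k i ≤ d k)
    (hle : ∀ k, Nat.card {k' // s k k'} * d k ≤ ∑ i, δ k i)
    (hs : ∀ k k' i, δ k i ≠ 0 → δ k' i ≠ 0 → s k k') :
    Fintype.card κ ≤ Fintype.card ι := by
  classical
  let F (c : Quotient s) : Finset ι := {i | δ c.out i ≠ 0}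
  have card_class_le (c : Quotient s) : #{k | Quotient.mk s k = c} ≤ #(F c) := by
    refine Nat.le_of_mul_le_mul_right ?_ (hd c.out)
    calc #{k | Quotient.mk s k = c} * d c.out
        = Nat.card {k' // s c.out k'} * d c.out := by
          rw [Nat.card_eq_fintype_card, Fintype.card_subtype]
          congr 2
          ext k
          rw [Finset.mem_filter_univ, Finset.mem_filter_univ, eq_comm, ← Quotient.eq, c.out_eq]
      _ ≤ ∑ i, δ c.out i := hle _
      _ = ∑ i ∈ F c, δ c.out i := (Finset.sum_filter_ne_zero _).symm
      _ ≤ #(F c) * d c.out := Finset.sum_le_card_nsmul _ _ _ fun i _ => hδ _ i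
  have disjoint_F : (Set.univ : Set (Quotient s)).PairwiseDisjoint F := by
    intro c _ c' _ hcc'
    refine Finset.disjoint_left.2 fun i hi hi' => hcc' ?_
    rw [← c.out_eq, ← c'.out_eq]
    exact Quotient.sound (hs _ _ i (Finset.mem_filter.1 hi).2 (Finset.mem_filter.1 hi').2)
  calc Fintype.card κ
      = ∑ c : Quotient s, #{k | Quotient.mk s k = c} :=
        Finset.card_eq_sum_card_fiberwise fun _ _ => Finset.mem_univ _
    _ ≤ ∑ c : Quotient s, #(F c) := Finset.sum_le_sum fun c _ => card_class_le c
    _ = #(Finset.univ.biUnion F) :=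
        (Finset.card_biUnion fun c _ c' _ => disjoint_F trivial trivial).symm
    _ ≤ Fintype.card ι := Finset.card_le_univ _

end Combinatorics

section Factorization

variable {R M N L : Type*} [Ring R] [AddCommGroup M] [Module R M] [AddCommGroup N] [Module R N]
  [AddCommGroup L] [Module R L]

theorem exists_comp_eq_of_ker_le_ker {p : M →ₗ[R] N} (hp : Function.Surjective p) {q : M →ₗ[R] L}
    (h : LinearMap.ker p ≤ LinearMap.ker q) : ∃ r : N →ₗ[R] L, r ∘ₗ p = q := by
  refine ⟨(LinearMap.ker p).liftQ q h ∘ₗ (p.quotKerEquivOfSurjective hp).symm.toLinearMap, ?_⟩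
  ext x
  have : (p.quotKerEquivOfSurjective hp).symm (p x) = (LinearMap.ker p).mkQ x :=
    (LinearEquiv.symm_apply_eq _).2 rfl
  simp [this]

theorem exists_comp_eq_of_range_le_range {j : M →ₗ[R] N} (hj : Function.Injective j)
    {q : L →ₗ[R] N} (h : LinearMap.range q ≤ LinearMap.range j) : ∃ r : L →ₗ[R] M, j ∘ₗ r = q :=
  ⟨(LinearEquiv.ofInjective j hj).symm.toLinearMap ∘ₗ q.codRestrict _ fun x => h ⟨x, rfl⟩,
    LinearMap.ext fun x =>
      congrArg Subtype.val ((LinearEquiv.ofInjective j hj).apply_symm_apply ⟨q x, h ⟨x, rfl⟩⟩)⟩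

end Factorization

/-- The submodules of `M` form a chain. Unlike `IsUniserialModule`, this does not ask for finite
length; it passes to submodules and bounds the maps from simple modules into `M`. -/
def IsChainModule (R M : Type*) [Ring R] [AddCommGroup M] [Module R M] : Prop :=
  ∀ X Y : Submodule R M, X ≤ Y ∨ Y ≤ X

/-- `M` is not the sum of two proper submodules. The zero module counts as hollow. The notion
covers chain modules and indecomposable projectives, and bounds the maps to simple modules. -/
def IsHollowModule (R M : Type*) [Ring R] [AddCommGroup M] [Module R M] : Prop :=
  ∀ X Y : Submodule R M, X ⊔ Y = ⊤ → X = ⊤ ∨ Y = ⊤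

section ChainModules

variable {R M N : Type*} [Ring R] [AddCommGroup M] [Module R M] [AddCommGroup N] [Module R N]

theorem IsUniserialModule.isChainModule [IsNoetherian R M] [IsArtinian R M]
    (h : IsUniserialModule R M) : IsChainModule R M := by
  obtain ⟨s, -, hs⟩ := h
  have mem_s (X : Submodule R M) : X ∈ s := by
    obtain ⟨t, i, hi, ht⟩ :=
      LTSeries.exists_relSeries_covBy_and_head_eq_bot_and_last_eq_bot (RelSeries.singleton _ X)
    rw [← hs t ht]
    exact ⟨i 0, congrFun hi 0⟩
  exact fun X Y => CompositionSeries.total (mem_s X) (mem_s Y)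

theorem IsChainModule.of_injective (h : IsChainModule R M) (f : N →ₗ[R] M)
    (hf : Function.Injective f) : IsChainModule R N := fun X Y => by
  simpa only [Submodule.map_le_map_iff_of_injective hf] using h (X.map f) (Y.map f)

theorem IsChainModule.of_le {X Y : Submodule R M} (h : IsChainModule R Y) (hXY : X ≤ Y) :
    IsChainModule R X :=
  h.of_injective (Submodule.inclusion hXY) (Submodule.inclusion_injective hXY)

theorem IsChainModule.isHollowModule (h : IsChainModule R M) : IsHollowModule R M :=
  fun X Y hXY => (h X Y).symm.imp (fun hYX => by rwa [sup_eq_left.2 hYX] at hXY)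
    fun hXY' => by rwa [sup_eq_right.2 hXY'] at hXY

theorem IsChainModule.exists_forall_le {ι : Type*} [Finite ι] [Nonempty ι]
    (h : IsChainModule R M) (X : ι → Submodule R M) : ∃ i, ∀ j, X j ≤ X i := by
  obtain ⟨_, ⟨i, rfl⟩, hi⟩ := (Set.finite_range X).exists_maximal (Set.range_nonempty X)
  exact ⟨i, fun j => (h (X j) (X i)).elim id fun hij => hi ⟨j, rfl⟩ hij⟩

theorem IsHollowModule.eq_of_isCoatom (h : IsHollowModule R M) {X Y : Submodule R M}
    (hX : IsCoatom X) (hY : IsCoatom Y) : X = Y :=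
  by_contra fun hXY => (h X Y (hX.sup_eq_top_of_ne hY hXY)).elim hX.1 hY.1

theorem IsChainModule.eq_of_isAtom (h : IsChainModule R M) {X Y : Submodule R M}
    (hX : IsAtom X) (hY : IsAtom Y) : X = Y :=
  (h X Y).elim (fun hXY => (hY.le_iff_eq hX.1).1 hXY) fun hYX => ((hX.le_iff_eq hY.1).1 hYX).symm

variable {S S' : Type*} [AddCommGroup S] [Module R S] [IsSimpleModule R S]

theorem isAtom_range_of_ne_zero {j : S →ₗ[R] M} (hj : j ≠ 0) : IsAtom (LinearMap.range j) :=
  isSimpleModule_iff_isAtom.1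
    (.congr (LinearEquiv.ofInjective j (LinearMap.injective_of_ne_zero hj)).symm)

variable [AddCommGroup S'] [Module R S'] [IsSimpleModule R S']

theorem IsHollowModule.exists_comp_eq (h : IsHollowModule R M) {p : M →ₗ[R] S} (hp : p ≠ 0)
    (q : M →ₗ[R] S') : ∃ r : S →ₗ[R] S', r ∘ₗ p = q := by
  rcases eq_or_ne q 0 with rfl | hq
  · exact ⟨0, LinearMap.zero_comp p⟩
  have hsurj := LinearMap.surjective_of_ne_zero hp
  exact exists_comp_eq_of_ker_le_ker hsurj (h.eq_of_isCoatom
    (LinearMap.isCoatom_ker_of_surjective hsurj)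
    (LinearMap.isCoatom_ker_of_surjective (LinearMap.surjective_of_ne_zero hq))).le

theorem IsChainModule.exists_comp_eq (h : IsChainModule R M) {j : S →ₗ[R] M} (hj : j ≠ 0)
    (q : S' →ₗ[R] M) : ∃ r : S' →ₗ[R] S, j ∘ₗ r = q := by
  rcases eq_or_ne q 0 with rfl | hq
  · exact ⟨0, LinearMap.comp_zero j⟩
  exact exists_comp_eq_of_range_le_range (LinearMap.injective_of_ne_zero hj)
    (h.eq_of_isAtom (isAtom_range_of_ne_zero hq) (isAtom_range_of_ne_zero hj)).le

theorem nonempty_linearEquiv_of_ne_zero {r : S →ₗ[R] S'} (hr : r ≠ 0) : Nonempty (S ≃ₗ[R] S') :=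
  ⟨.ofBijective r (LinearMap.bijective_of_ne_zero hr)⟩

end ChainModules

section LinearAlgebra

variable {K X Y Z H : Type*} [Field K] [AddCommGroup X] [Module K X] [AddCommGroup Y] [Module K Y]
  [AddCommGroup Z] [Module K Z] [AddCommGroup H] [Module K H]

theorem finrank_le_add_of_ker_le_range [Module.Finite K X] [Module.Finite K Y] [Module.Finite K Z]
    {F : X →ₗ[K] Y} {G : Y →ₗ[K] Z} (h : LinearMap.ker G ≤ LinearMap.range F) :
    Module.finrank K Y ≤ Module.finrank K X + Module.finrank K Z := by
  calc Module.finrank K Y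
      = Module.finrank K (LinearMap.ker G) + Module.finrank K (LinearMap.range G) := by
        rw [add_comm, G.finrank_range_add_finrank_ker]
    _ ≤ Module.finrank K X + Module.finrank K Z :=
        add_le_add ((Submodule.finrank_mono h).trans F.finrank_range_le) G.range.finrank_le

theorem finrank_le_finrank_of_forall_exists_sub_mem [Module.Finite K Y] (b : X →ₗ[K] Y →ₗ[K] H)
    {E : Submodule K H} {θ : H} (hθ : θ ∉ E) (hb : ∀ x ≠ 0, ∃ y, θ - b x y ∈ E) :
    Module.finrank K X ≤ Module.finrank K Y := by
  obtain ⟨φ, hφθ, hφE⟩ := Submodule.exists_dual_map_eq_bot_of_notMem hθ inferInstance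
  have hφ (z : H) (hz : z ∈ E) : φ z = 0 := by
    simpa only [hφE, Submodule.mem_bot] using Submodule.mem_map_of_mem (f := φ) hz
  have injective_pairing : Function.Injective (b.compr₂ φ) := by
    refine (injective_iff_map_eq_zero _).2 fun x hx => by_contra fun hx0 => ?_
    obtain ⟨y, hy⟩ := hb x hx0
    have hxy : φ (b x y) = 0 := LinearMap.congr_fun hx y
    have hθxy : φ θ - φ (b x y) = 0 := by rw [← map_sub, hφ _ hy]
    exact hφθ (by rwa [hxy, sub_zero] at hθxy)
  exact (LinearMap.finrank_le_finrank_of_injective injective_pairing).trans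
    Subspace.dual_finrank_eq.le

end LinearAlgebra

section HomDimensions

variable (K : Type*) {R L M N S : Type*} [Field K] [Ring R] [Algebra K R]
  [AddCommGroup L] [Module R L] [AddCommGroup M] [Module R M] [AddCommGroup N] [Module R N]
  [AddCommGroup S] [Module R S]

theorem exists_ne_zero_of_finrank_hom_ne_zero [Module K N] [IsScalarTower K R N]
    (h : Module.finrank K (M →ₗ[R] N) ≠ 0) : ∃ q : M →ₗ[R] N, q ≠ 0 :=
  have := Module.nontrivial_of_finrank_pos (Nat.pos_of_ne_zero h)
  exists_ne 0

variable [Module K S] [IsScalarTower K R S]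

theorem IsHollowModule.finrank_hom_le [IsSimpleModule R S] [Module.Finite K (S →ₗ[R] S)]
    (h : IsHollowModule R M) :
    Module.finrank K (M →ₗ[R] S) ≤ Module.finrank K (S →ₗ[R] S) := by
  by_cases h0 : Module.finrank K (M →ₗ[R] S) = 0
  · exact h0.trans_le (Nat.zero_le _)
  obtain ⟨p, hp⟩ := exists_ne_zero_of_finrank_hom_ne_zero K h0
  exact LinearMap.finrank_le_finrank_of_surjective
    (f := (LinearMap.lcomp K S p : (S →ₗ[R] S) →ₗ[K] (M →ₗ[R] S))) (h.exists_comp_eq hp)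

theorem IsChainModule.finrank_hom_le [IsSimpleModule R S] [Module.Finite K (S →ₗ[R] S)]
    [Module K M] [IsScalarTower K R M] (h : IsChainModule R M) :
    Module.finrank K (S →ₗ[R] M) ≤ Module.finrank K (S →ₗ[R] S) := by
  by_cases h0 : Module.finrank K (S →ₗ[R] M) = 0
  · exact h0.trans_le (Nat.zero_le _)
  obtain ⟨j, hj⟩ := exists_ne_zero_of_finrank_hom_ne_zero K h0
  exact LinearMap.finrank_le_finrank_of_surjective
    (f := (LinearMap.compRight K j : (S →ₗ[R] S) →ₗ[K] (S →ₗ[R] M))) (h.exists_comp_eq hj)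

variable [Module K L] [IsScalarTower K R L] [Module K M] [IsScalarTower K R M]

instance finite_submodule [Module.Finite K M] (X : Submodule R M) : Module.Finite K X :=
  Module.Finite.of_injective (X.subtype.restrictScalars K) X.subtype_injective

variable [Module.Finite K S]

instance finite_hom [Module.Finite K M] : Module.Finite K (M →ₗ[R] S) :=
  Module.Finite.of_injective (LinearMap.restrictScalarsₗ K R M S K)
    (LinearMap.restrictScalars_injective K)

theorem finrank_hom_le_of_surjective [Module.Finite K M] {p : M →ₗ[R] N}
    (hp : Function.Surjective p) :
    Module.finrank K (N →ₗ[R] S) ≤ Module.finrank K (M →ₗ[R] S) :=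
  LinearMap.finrank_le_finrank_of_injective
    (f := (LinearMap.lcomp K S p : (N →ₗ[R] S) →ₗ[K] (M →ₗ[R] S)))
    fun _ _ h => LinearMap.ext <| hp.forall.2 (LinearMap.congr_fun h)

variable [Module K N] [IsScalarTower K R N]

theorem finrank_hom_le_of_injective [Module.Finite K N] {j : M →ₗ[R] N}
    (hj : Function.Injective j) :
    Module.finrank K (S →ₗ[R] M) ≤ Module.finrank K (S →ₗ[R] N) :=
  LinearMap.finrank_le_finrank_of_injective
    (f := (LinearMap.compRight K j : (S →ₗ[R] M) →ₗ[K] (S →ₗ[R] N)))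
    fun _ _ h => LinearMap.ext fun x => hj (LinearMap.congr_fun h x)

theorem finrank_hom_le_add_of_exact_of_injective [Module.Finite K L] [Module.Finite K M]
    [Module.Finite K N] {f : L →ₗ[R] M} {g : M →ₗ[R] N} (hf : Function.Injective f)
    (hfg : Function.Exact f g) :
    Module.finrank K (S →ₗ[R] M) ≤
      Module.finrank K (S →ₗ[R] L) + Module.finrank K (S →ₗ[R] N) := by
  refine finrank_le_add_of_ker_le_range (F := LinearMap.compRight K f)
    (G := LinearMap.compRight K g) fun q hq => ?_
  refine exists_comp_eq_of_range_le_range hf ?_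
  rintro _ ⟨s, rfl⟩
  exact (hfg _).1 (LinearMap.congr_fun hq s)

theorem finrank_hom_le_add_of_exact_of_surjective [Module.Finite K L] [Module.Finite K M]
    [Module.Finite K N] {f : L →ₗ[R] M} {g : M →ₗ[R] N} (hg : Function.Surjective g)
    (hfg : Function.Exact f g) :
    Module.finrank K (M →ₗ[R] S) ≤
      Module.finrank K (L →ₗ[R] S) + Module.finrank K (N →ₗ[R] S) := by
  rw [add_comm]
  refine finrank_le_add_of_ker_le_range (F := LinearMap.lcomp K S g)
    (G := LinearMap.lcomp K S f) fun q hq => ?_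
  refine exists_comp_eq_of_ker_le_ker hg fun x hx => ?_
  obtain ⟨y, rfl⟩ := (hfg x).1 hx
  exact LinearMap.congr_fun hq y

theorem finrank_hom_iSup_le_sum [Module.Finite K M] {ι : Type*} [Fintype ι]
    (X : ι → Submodule R M) :
    Module.finrank K (↥(⨆ i, X i) →ₗ[R] S) ≤ ∑ i, Module.finrank K (X i →ₗ[R] S) := by
  let restrict : (↥(⨆ i, X i) →ₗ[R] S) →ₗ[K] ∀ i, X i →ₗ[R] S :=
    LinearMap.pi fun i => LinearMap.lcomp K S (Submodule.inclusion (le_iSup X i))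
  have injective_restrict : Function.Injective restrict := by
    refine (injective_iff_map_eq_zero restrict).2 fun t ht => ?_
    have le_ker (i : ι) : X i ≤ (LinearMap.ker t).map (⨆ i, X i).subtype := fun x hx =>
      ⟨⟨x, le_iSup X i hx⟩, LinearMap.congr_fun (congrFun ht i) ⟨x, hx⟩, rfl⟩
    ext ⟨x, hx⟩
    obtain ⟨y, hy, rfl⟩ := iSup_le le_ker hx
    exact hy
  exact (LinearMap.finrank_le_finrank_of_injective injective_restrict).trans
    (Module.finrank_pi_fintype K).le

theorem finrank_hom_le_sum_update_of_sup_eq_iSup [Module.Finite K M] {ι : Type*} [Fintype ι]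
    [DecidableEq ι] {V : Submodule R M} {W : ι → Submodule R M} {i₀ : ι}
    (h : V ⊔ W i₀ = ⨆ i, W i) :
    Module.finrank K (V →ₗ[R] S) ≤
      ∑ i, Module.finrank K (Function.update W i₀ (V ⊓ W i₀) i →ₗ[R] S) := by
  let π := (W i₀).mkQ
  have map_V : V.map π = ⨆ i : {i // i ≠ i₀}, (W i).map π := by
    calc V.map π = (V ⊔ W i₀).map π := by
          rw [Submodule.map_sup, Submodule.mkQ_map_self, sup_bot_eq]
      _ = ⨆ i, (W i).map π := by rw [h, Submodule.map_iSup]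
      _ = ⨆ i : {i // i ≠ i₀}, (W i).map π := by
          rw [iSup_split_single _ i₀, Submodule.mkQ_map_self, bot_sup_eq, iSup_subtype']
  have exact_V : Function.Exact (Submodule.inclusion (inf_le_left : V ⊓ W i₀ ≤ V))
      (π.submoduleMap V) := by
    intro v
    have : π.submoduleMap V v = 0 ↔ (v : M) ∈ W i₀ :=
      Subtype.ext_iff.trans (Submodule.Quotient.mk_eq_zero _)
    rw [this]
    exact ⟨fun hv => ⟨⟨v, v.2, hv⟩, rfl⟩, by rintro ⟨w, rfl⟩; exact w.2.2⟩
  calc Module.finrank K (V →ₗ[R] S)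
      ≤ Module.finrank K (↥(V ⊓ W i₀) →ₗ[R] S) + Module.finrank K (V.map π →ₗ[R] S) :=
        finrank_hom_le_add_of_exact_of_surjective K (π.submoduleMap_surjective V) exact_V
    _ ≤ Module.finrank K (↥(V ⊓ W i₀) →ₗ[R] S) +
          ∑ i : {i // i ≠ i₀}, Module.finrank K (W i →ₗ[R] S) := by
        rw [map_V]
        exact Nat.add_le_add_left ((finrank_hom_iSup_le_sum K _).trans <| Finset.sum_le_sum
          fun i _ => finrank_hom_le_of_surjective K (π.submoduleMap_surjective (W i.1))) _
    _ = ∑ i, Module.finrank K (Function.update W i₀ (V ⊓ W i₀) i →ₗ[R] S) := by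
        rw [Fintype.sum_eq_add_sum_subtype_ne _ i₀, Function.update_self]
        congr 1
        exact Finset.sum_congr rfl fun i _ => by rw [Function.update_of_ne i.2]

theorem sum_finrank_hom_le_of_iSupIndep [Module.Finite K M] {κ : Type*} [Fintype κ]
    {σ : κ → Submodule R M} (hσ : iSupIndep σ) :
    ∑ k, Module.finrank K (S →ₗ[R] σ k) ≤ Module.finrank K (S →ₗ[R] M) := by
  classical
  let sum : (∀ k, S →ₗ[R] σ k) →ₗ[K] (S →ₗ[R] M) :=
    ∑ k, LinearMap.compRight K (σ k).subtype ∘ₗ LinearMap.proj k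
  have injective_sum : Function.Injective sum := by
    refine (injective_iff_map_eq_zero sum).2 fun e he => ?_
    ext k x
    have hsum : ∑ k, (e k x : M) = 0 := by
      simpa [sum, LinearMap.sum_apply] using LinearMap.congr_fun he x
    exact (iSupIndep_iff_finsetSum_eq_zero_imp_eq_zero σ).1 hσ Finset.univ _
      (fun k _ => (e k x).2) hsum k (Finset.mem_univ k)
  calc ∑ k, Module.finrank K (S →ₗ[R] σ k)
      = Module.finrank K (∀ k, S →ₗ[R] σ k) := (Module.finrank_pi_fintype K).symm
    _ ≤ Module.finrank K (S →ₗ[R] M) := LinearMap.finrank_le_finrank_of_injective injective_sum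

end HomDimensions

section Counting

variable (K : Type*) {R M : Type*} [Field K] [Ring R] [Algebra K R] [AddCommGroup M] [Module R M]
  [Module K M] [IsScalarTower K R M] [Module.Finite K M] {κ : Type*} {σ : κ → Submodule R M}

theorem card_linearEquiv_mul_finrank_end_le [Finite κ] (hσ : iSupIndep σ) (k : κ) :
    Nat.card {k' // Nonempty (σ k ≃ₗ[R] σ k')} * Module.finrank K (σ k →ₗ[R] σ k) ≤
      Module.finrank K (σ k →ₗ[R] M) := by
  classical
  have := Fintype.ofFinite κ
  let T := {k' // Nonempty (σ k ≃ₗ[R] σ k')}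
  calc Nat.card T * Module.finrank K (σ k →ₗ[R] σ k)
      = ∑ _t : T, Module.finrank K (σ k →ₗ[R] σ k) := by
        rw [Finset.sum_const, Finset.card_univ, Nat.card_eq_fintype_card, smul_eq_mul]
    _ ≤ ∑ t : T, Module.finrank K (σ k →ₗ[R] σ t) :=
        Finset.sum_le_sum fun t _ => t.2.elim fun e =>
          finrank_hom_le_of_injective K (j := e.toLinearMap) e.injective
    _ ≤ Module.finrank K (σ k →ₗ[R] M) :=
        sum_finrank_hom_le_of_iSupIndep K (hσ.comp Subtype.val_injective)

variable [Fintype κ] {ι ι' : Type*} [Fintype ι] [Fintype ι'] {X : ι → Type*}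
  [∀ i, AddCommGroup (X i)] [∀ i, Module R (X i)] {Y : ι' → Type*} [∀ j, AddCommGroup (Y j)]
  [∀ j, Module R (Y j)] [∀ j, Module K (Y j)] [∀ j, IsScalarTower K R (Y j)]

theorem card_le_card_add_card_of_isSimpleModule (hσ : iSupIndep σ)
    (hσs : ∀ k, IsSimpleModule R (σ k)) (hX : ∀ i, IsHollowModule R (X i))
    (hY : ∀ j, IsChainModule R (Y j))
    (hle : ∀ k, Module.finrank K (σ k →ₗ[R] M) ≤
      ∑ i, Module.finrank K (X i →ₗ[R] σ k) + ∑ j, Module.finrank K (σ k →ₗ[R] Y j)) :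
    Fintype.card κ ≤ Fintype.card ι + Fintype.card ι' := by
  rw [← Fintype.card_sum]
  let iso : Setoid κ := ⟨fun k k' => Nonempty (σ k ≃ₗ[R] σ k'),
    fun k => ⟨.refl R _⟩, fun ⟨e⟩ => ⟨e.symm⟩, fun ⟨e⟩ ⟨e'⟩ => ⟨e ≪≫ₗ e'⟩⟩
  refine card_le_card_of_forall_card_mul_le_sum iso (fun k => Module.finrank K (σ k →ₗ[R] σ k))
    (fun k => Sum.elim (fun i => Module.finrank K (X i →ₗ[R] σ k))
      fun j => Module.finrank K (σ k →ₗ[R] Y j)) (fun k => ?_) ?_ (fun k => ?_) ?_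
  · have := IsSimpleModule.nontrivial R (σ k)
    exact Module.finrank_pos_iff_exists_ne_zero.2 ⟨LinearMap.id, one_ne_zero⟩
  · rintro k (i | j)
    · exact (hX i).finrank_hom_le K
    · exact (hY j).finrank_hom_le K
  · rw [Fintype.sum_sum_type]
    exact (card_linearEquiv_mul_finrank_end_le K hσ k).trans (hle k)
  · rintro k k' (i | j) hk hk'
    · obtain ⟨p, hp⟩ := exists_ne_zero_of_finrank_hom_ne_zero K hk
      obtain ⟨p', hp'⟩ := exists_ne_zero_of_finrank_hom_ne_zero K hk'
      obtain ⟨r, rfl⟩ := (hX i).exists_comp_eq hp p'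
      exact nonempty_linearEquiv_of_ne_zero (r := r) fun hr => hp' (by rw [hr, LinearMap.zero_comp])
    · obtain ⟨q, hq⟩ := exists_ne_zero_of_finrank_hom_ne_zero K hk
      obtain ⟨q', hq'⟩ := exists_ne_zero_of_finrank_hom_ne_zero K hk'
      obtain ⟨r, rfl⟩ := (hY j).exists_comp_eq hq' q
      exact nonempty_linearEquiv_of_ne_zero (r := r) fun hr => hq (by rw [hr, LinearMap.comp_zero])

theorem card_le_card_add_card_of_ne_bot (hσ : iSupIndep σ) (hσ0 : ∀ k, σ k ≠ ⊥)
    (hX : ∀ i, IsHollowModule R (X i)) (hY : ∀ j, IsChainModule R (Y j))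
    (hle : ∀ S : Submodule R M, IsSimpleModule R S → Module.finrank K (S →ₗ[R] M) ≤
      ∑ i, Module.finrank K (X i →ₗ[R] S) + ∑ j, Module.finrank K (S →ₗ[R] Y j)) :
    Fintype.card κ ≤ Fintype.card ι + Fintype.card ι' := by
  have : IsArtinian R M := isArtinian_of_tower K inferInstance
  choose τ hτ hτσ using fun k => (eq_bot_or_exists_atom_le (σ k)).resolve_left (hσ0 k)
  have hτs (k : κ) : IsSimpleModule R (τ k) := isSimpleModule_iff_isAtom.2 (hτ k)
  exact card_le_card_add_card_of_isSimpleModule K (hσ.mono hτσ) hτs hX hY fun k => hle _ (hτs k)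

end Counting

section Hollow

variable {R P Q : Type*} [Ring R] [AddCommGroup P] [Module R P] [AddCommGroup Q] [Module R Q]

theorem IsHollowModule.le_of_isCoatom (h : IsHollowModule R P) {J X : Submodule R P}
    (hJ : IsCoatom J) (hX : X ≠ ⊤) : X ≤ J :=
  sup_eq_right.1 ((hJ.le_iff.1 le_sup_right).resolve_left fun htop => (h X J htop).elim hX hJ.1)

theorem IsHollowModule.of_surjective (h : IsHollowModule R P) {f : P →ₗ[R] Q}
    (hf : Function.Surjective f) : IsHollowModule R Q := by
  intro X Y hXY
  have hsup : X.comap f ⊔ Y.comap f = ⊤ := by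
    have hker : LinearMap.ker f ≤ X.comap f ⊔ Y.comap f :=
      (Submodule.comap_mono bot_le).trans le_sup_left
    rw [← Submodule.comap_map_eq_self hker, Submodule.map_sup,
      Submodule.map_comap_eq_of_surjective hf, Submodule.map_comap_eq_of_surjective hf, hXY,
      Submodule.comap_top]
  have of_comap {Z : Submodule R Q} (hZ : Z.comap f = ⊤) : Z = ⊤ :=
    Submodule.comap_injective_of_surjective hf (hZ.trans (Submodule.comap_top f).symm)
  exact (h _ _ hsup).imp of_comap of_comap

theorem IsHollowModule.injective_of_comp_eq_id [Nontrivial Q] (h : IsHollowModule R P)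
    {f : P →ₗ[R] Q} {s : Q →ₗ[R] P} (hs : f ∘ₗ s = LinearMap.id) : Function.Injective f := by
  have hsf : Function.LeftInverse f s := LinearMap.congr_fun hs
  have hsup : LinearMap.ker f ⊔ LinearMap.range s = ⊤ := eq_top_iff.2 fun x _ =>
    Submodule.mem_sup.2 ⟨x - s (f x), LinearMap.sub_mem_ker_iff.2 (hsf (f x)).symm, s (f x),
      ⟨f x, rfl⟩, sub_add_cancel x _⟩
  rcases h _ _ hsup with hker | hrange
  · rw [LinearMap.ker_eq_top.1 hker, LinearMap.zero_comp] at hs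
    obtain ⟨y, hy⟩ := exists_ne (0 : Q)
    exact absurd (LinearMap.congr_fun hs y).symm hy
  · exact (hsf.rightInverse_of_surjective (LinearMap.range_eq_top.1 hrange)).injective

theorem IsHollowModule.isCoatom_jacobson [Nontrivial P] [Module.Finite R P]
    (h : IsHollowModule R P) : IsCoatom (Module.jacobson R P) := by
  obtain ⟨J, hJ, -⟩ := (eq_top_or_exists_le_coatom (⊥ : Submodule R P)).resolve_left bot_ne_top
  have coatoms_eq : {X : Submodule R P | IsCoatom X} = {J} :=
    Set.eq_singleton_iff_unique_mem.2 ⟨hJ, fun X hX => h.eq_of_isCoatom hX hJ⟩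
  rwa [Module.jacobson, coatoms_eq, sInf_singleton]

theorem exists_end_range_le_mkQ_comp_eq [Module.Projective R P] {X Y : Submodule R P}
    (h : X ⊔ Y = ⊤) : ∃ φ : Module.End R P, LinearMap.range φ ≤ X ∧ Y.mkQ ∘ₗ φ = Y.mkQ := by
  have hsurj : Function.Surjective (Y.mkQ ∘ₗ X.subtype) := by
    rw [← LinearMap.range_eq_top, LinearMap.range_comp, X.range_subtype, ← Y.range_mkQ,
      ← Submodule.map_top, ← h, Submodule.map_sup, Y.mkQ_map_self, sup_bot_eq]
  obtain ⟨s, hs⟩ := Module.projective_lifting_property _ Y.mkQ hsurj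
  exact ⟨X.subtype ∘ₗ s, (LinearMap.range_comp_le_range _ _).trans X.range_subtype.le, hs⟩

theorem IsIndecomposableModule.isHollowModule [Module.Projective R P] [IsNoetherian R P]
    [IsArtinian R P] (h : IsIndecomposableModule R P) : IsHollowModule R P := by
  intro X Y hXY
  obtain ⟨φ, hφX, hφY⟩ := exists_end_range_le_mkQ_comp_eq hXY
  obtain ⟨n, hn⟩ := Filter.eventually_atTop.1 φ.eventually_isCompl_ker_pow_range_pow
  have fitting := hn (n + 1) n.le_succ
  refine (h.2 _ _ fitting).imp (fun hker => ?_) fun hrange => ?_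
  · have hrange : LinearMap.range (φ ^ (n + 1)) = ⊤ := by
      simpa only [hker, bot_sup_eq] using fitting.sup_eq_top
    rw [← top_le_iff, ← hrange, pow_succ']
    exact (LinearMap.range_comp_le_range _ _).trans hφX
  · have mkQ_comp_pow (k : ℕ) : Y.mkQ ∘ₗ φ ^ k = Y.mkQ := by
      induction k with
      | zero => rfl
      | succ k ih => rw [pow_succ, Module.End.mul_eq_comp, ← LinearMap.comp_assoc, ih, hφY]
    rw [← Y.ker_mkQ, ← mkQ_comp_pow (n + 1), LinearMap.range_eq_bot.1 hrange,
      LinearMap.comp_zero, LinearMap.ker_zero]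

end Hollow

section Idempotents

variable {R U : Type*} [Ring R] [AddCommGroup U] [Module R U] {e f g : R}

theorem mul_eq_of_mem_span_singleton (he : IsIdempotentElem e) {x : R}
    (hx : x ∈ Submodule.span R {e}) : x * e = x := by
  obtain ⟨c, rfl⟩ := Submodule.mem_span_singleton.1 hx
  rw [smul_eq_mul, mul_assoc, he.eq]

theorem projective_span_singleton (he : IsIdempotentElem e) :
    Module.Projective R (Submodule.span R {e}) :=
  Module.Projective.of_split (Submodule.span R {e}).subtype
    (LinearMap.toSpanSingleton R _ ⟨e, Submodule.mem_span_singleton_self e⟩) <|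
    LinearMap.ext fun x => Subtype.ext (mul_eq_of_mem_span_singleton he x.2)

theorem comap_subtype_radicalMul (he : IsIdempotentElem e) :
    (radicalMul e).comap (Submodule.span R {e}).subtype =
      Module.jacobson R (Submodule.span R {e}) := by
  refine le_antisymm ?_ fun x hx => ?_
  · rintro x ⟨y, hy, hyx⟩
    obtain rfl : LinearMap.toSpanSingleton R _ ⟨e, Submodule.mem_span_singleton_self e⟩ y = x :=
      Subtype.ext hyx
    exact Module.le_comap_jacobson _ hy
  · exact ⟨x, Module.le_comap_jacobson (Submodule.subtype _) hx,
      mul_eq_of_mem_span_singleton he x.2⟩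

theorem radicalMul_le_span_singleton (e : R) : radicalMul e ≤ Submodule.span R {e} := by
  rw [← LinearMap.range_toSpanSingleton]
  exact LinearMap.map_le_range

theorem IsLeftMultiserial.exists_iSup_eq_jacobson [IsArtinianRing R] {m : ℕ}
    (hR : IsLeftMultiserial m R) (he : IsPrimitiveIdempotent e) :
    ∃ W : Fin m → Submodule R (Submodule.span R {e}),
      (∀ i, IsChainModule R (W i)) ∧ ⨆ i, W i = Module.jacobson R (Submodule.span R {e}) := by
  obtain ⟨V, hV, hVJ⟩ := hR e he
  let P := Submodule.span R {e}
  have hJP : radicalMul e ≤ P := radicalMul_le_span_singleton e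
  have hVP (i : Fin m) : V i ≤ P := (hVJ ▸ le_iSup V i).trans hJP
  refine ⟨fun i => (V i).comap P.subtype, fun i => (hV i).isChainModule.of_injective
    (Submodule.comapSubtypeEquivOfLe (hVP i)).toLinearMap (LinearEquiv.injective _), ?_⟩
  rw [← comap_subtype_radicalMul he.2.1]
  refine Submodule.map_injective_of_injective P.subtype_injective ?_
  rw [Submodule.map_iSup, Submodule.map_comap_subtype, inf_eq_right.2 hJP, ← hVJ]
  exact iSup_congr fun i => by rw [Submodule.map_comap_subtype, inf_eq_right.2 (hVP i)]

theorem IsPrimitiveIdempotent.isIndecomposableModule_span_singleton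
    (he : IsPrimitiveIdempotent e) : IsIndecomposableModule R (Submodule.span R {e}) := by
  obtain ⟨he0, hee, hprim⟩ := he
  let P := Submodule.span R {e}
  let ε : P := ⟨e, Submodule.mem_span_singleton_self e⟩
  have smul_ε (x : P) : (x : R) • ε = x := Subtype.ext (mul_eq_of_mem_span_singleton hee x.2)
  have eq_top {N : Submodule R P} (hN : ε ∈ N) : N = ⊤ :=
    eq_top_iff.2 fun x _ => smul_ε x ▸ N.smul_mem _ hN
  have orthogonal {N N' : Submodule R P} (hNN' : Disjoint N N') {x y : P} (hx : x ∈ N)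
      (hy : y ∈ N') (hxy : x + y = ε) : (x : R) • y = 0 := by
    refine Submodule.disjoint_def.1 hNN' _ ?_ (N'.smul_mem _ hy)
    have : (x : R) • y = x - (x : R) • x := by
      rw [eq_sub_iff_add_eq', ← smul_add, hxy, smul_ε]
    exact this ▸ N.sub_mem hx (N.smul_mem _ hx)
  have idempotent {x y : P} (hxy : x + y = ε) (h : (x : R) • y = 0) :
      IsIdempotentElem (x : R) := by
    have : (x : R) • x = x := by simpa only [hxy, smul_ε, h, add_zero] using
      (smul_add (x : R) x y).symm
    exact congrArg Subtype.val this
  refine ⟨⟨ε, 0, fun h => he0 (congrArg Subtype.val h)⟩, fun N N' hNN' => ?_⟩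
  obtain ⟨x, hx, y, hy, hxy⟩ : ∃ x ∈ N, ∃ y ∈ N', x + y = ε :=
    Submodule.mem_sup.1 (hNN'.sup_eq_top ▸ Submodule.mem_top)
  have hyx : y + x = ε := (add_comm y x).trans hxy
  have hxy0 := orthogonal hNN'.disjoint hx hy hxy
  have hyx0 := orthogonal hNN'.symm.disjoint hy hx hyx
  rcases hprim x y (idempotent hxy hxy0) (idempotent hyx hyx0) (congrArg Subtype.val hxy0)
    (congrArg Subtype.val hyx0) (congrArg Subtype.val hxy.symm) with h | h
  · obtain rfl : x = 0 := Subtype.ext h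
    rw [zero_add] at hxy
    exact .inl (by simpa only [eq_top (hxy ▸ hy), disjoint_top] using hNN'.disjoint)
  · obtain rfl : y = 0 := Subtype.ext h
    rw [add_zero] at hxy
    exact .inr (by simpa only [eq_top (hxy ▸ hx), top_disjoint] using hNN'.disjoint)

theorem span_singleton_lt_span_singleton_add (hf : IsIdempotentElem f) (hfg : f * g = 0)
    (hgf : g * f = 0) (hg : g ≠ 0) : Submodule.span R {f} < Submodule.span R {f + g} := by
  refine lt_of_le_not_ge ?_ fun hle => hg ?_
  · rw [Submodule.span_singleton_le_iff_mem, Submodule.mem_span_singleton]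
    exact ⟨f, by rw [smul_eq_mul, mul_add, hf.eq, hfg, add_zero]⟩
  · have hmem := hle (Submodule.mem_span_singleton_self (f + g))
    simpa [add_mul, hf.eq, hgf] using mul_eq_of_mem_span_singleton hf hmem

/- Any decomposition `e = f + g` of an idempotent with `e • u ∉ M` can be refined on the side of `f`
or of `g`, and `Rf`, `Rg` are strictly smaller than `Re`. -/
theorem exists_isPrimitiveIdempotent_smul_notMem [IsArtinianRing R] {M : Submodule R U}
    (hM : M ≠ ⊤) : ∃ e : R, IsPrimitiveIdempotent e ∧ ∃ u : U, e • u ∉ M := by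
  obtain ⟨u, -, hu⟩ := SetLike.exists_of_lt (lt_top_iff_ne_top.2 hM)
  suffices h : ∀ (I : Ideal R) (e : R), I = Submodule.span R {e} → IsIdempotentElem e → e • u ∉ M →
      ∃ e : R, IsPrimitiveIdempotent e ∧ ∃ u : U, e • u ∉ M from
    h _ 1 rfl .one (by rwa [one_smul])
  intro I
  induction I using WellFoundedLT.induction with
  | ind I ih =>
    rintro e rfl he heu
    by_cases hprim : IsPrimitiveIdempotent e
    · exact ⟨e, hprim, u, heu⟩
    have he0 : e ≠ 0 := by rintro rfl; exact heu (by rw [zero_smul]; exact M.zero_mem)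
    obtain ⟨f, g, hf, hg, hfg, hgf, rfl, hf0, hg0⟩ : ∃ f g : R, IsIdempotentElem f ∧
        IsIdempotentElem g ∧ f * g = 0 ∧ g * f = 0 ∧ e = f + g ∧ f ≠ 0 ∧ g ≠ 0 := by
      by_contra! h
      exact hprim ⟨he0, he, fun f g hf hg hfg hgf hefg => or_iff_not_imp_left.2
        (h f g hf hg hfg hgf hefg)⟩
    by_cases hfu : f • u ∈ M
    · have hgu : g • u ∉ M := fun hgu => heu (add_smul f g u ▸ M.add_mem hfu hgu)
      exact ih _ (add_comm g f ▸ span_singleton_lt_span_singleton_add hg hgf hfg hf0) g rfl hg hgu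
    · exact ih _ (span_singleton_lt_span_singleton_add hf hfg hgf hg0) f rfl hf hfu

theorem IsHollowModule.exists_isPrimitiveIdempotent_surjective [IsArtinianRing R]
    [Module.Finite R U] [Nontrivial U] (hU : IsHollowModule R U) :
    ∃ e : R, IsPrimitiveIdempotent e ∧
      ∃ p : Submodule.span R {e} →ₗ[R] U, Function.Surjective p := by
  have hJ := hU.isCoatom_jacobson
  obtain ⟨e, he, u, hu⟩ := exists_isPrimitiveIdempotent_smul_notMem hJ.1
  let p := LinearMap.toSpanSingleton R U u ∘ₗ (Submodule.span R {e}).subtype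
  refine ⟨e, he, p, LinearMap.range_eq_top.1 ?_⟩
  by_contra hp
  exact hu (hU.le_of_isCoatom hJ hp ⟨⟨e, Submodule.mem_span_singleton_self e⟩, rfl⟩)

end Idempotents

section DirectSums

variable {R P B U ι : Type*} [Ring R] [AddCommGroup P] [Module R P] [AddCommGroup B] [Module R B]
  [AddCommGroup U] [Module R U] [Fintype ι]

theorem exists_end_range_le_sum_eq_id [DecidableEq ι] {N : ι → Submodule R B}
    (hN : DirectSum.IsInternal N) :
    ∃ π : ι → Module.End R B, (∀ i, LinearMap.range (π i) ≤ N i) ∧ ∑ i, π i = LinearMap.id := by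
  classical
  let E := LinearEquiv.ofBijective (DirectSum.coeLinearMap N) hN
  let component (i : ι) : B →ₗ[R] N i :=
    DirectSum.component R ι (fun i => N i) i ∘ₗ E.symm.toLinearMap
  refine ⟨fun i => (N i).subtype ∘ₗ component i, fun i =>
    (LinearMap.range_comp_le_range _ _).trans (N i).range_subtype.le, LinearMap.ext fun b => ?_⟩
  calc (∑ i, (N i).subtype ∘ₗ component i) b
      = ∑ i, (component i b : B) := LinearMap.sum_apply _ _ _
    _ = DirectSum.coeLinearMap N (E.symm b) :=
        ((DirectSum.coeLinearMap_eq_dfinsuppSum N (E.symm b)).trans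
          (DFinsupp.sum_eq_sum_fintype _ fun _ => rfl)).symm
    _ = b := E.apply_symm_apply b

theorem IsChainModule.exists_surjective_of_sum [Nontrivial U] (h : IsChainModule R U)
    {t : ι → P →ₗ[R] U} (ht : Function.Surjective (∑ i, t i : P →ₗ[R] U)) :
    ∃ i, Function.Surjective (t i) := by
  have : Nonempty ι := by
    by_contra hι
    rw [not_nonempty_iff] at hι
    obtain ⟨u, hu⟩ := exists_ne (0 : U)
    obtain ⟨x, rfl⟩ := ht u
    exact hu (by rw [Finset.univ_eq_empty, Finset.sum_empty, LinearMap.zero_apply])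
  obtain ⟨i, hi⟩ := h.exists_forall_le fun i => LinearMap.range (t i)
  refine ⟨i, ht.forall.2 fun x => ?_⟩
  rw [LinearMap.sum_apply]
  exact Submodule.sum_mem _ fun j _ => hi j ⟨x, rfl⟩

end DirectSums

section Length

variable {R P U : Type*} [Ring R] [AddCommGroup P] [Module R P] [AddCommGroup U] [Module R U]

theorem length_eq_length_add_one_of_covBy {X Y : Submodule R P} (h : X ⋖ Y) :
    Module.length R Y = Module.length R X + 1 := by
  have : IsSimpleModule R (Y ⧸ X.submoduleOf Y) := (covBy_iff_quot_is_simple h.le).1 h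
  rw [← Module.length_eq_one R (Y ⧸ X.submoduleOf Y),
    ← (Submodule.submoduleOfEquivOfLe h.le).length_eq]
  exact Module.length_eq_add_of_exact (X.submoduleOf Y).subtype (X.submoduleOf Y).mkQ
    (Submodule.subtype_injective _) (Submodule.mkQ_surjective _) (LinearMap.exact_subtype_mkQ _)

theorem length_ker_eq_length_ker [IsNoetherian R P] [IsArtinian R P] {p t : P →ₗ[R] U}
    (hp : Function.Surjective p) (ht : Function.Surjective t) :
    Module.length R (LinearMap.ker p) = Module.length R (LinearMap.ker t) := by
  have length_P {q : P →ₗ[R] U} (hq : Function.Surjective q) :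
      Module.length R P = Module.length R (LinearMap.ker q) + Module.length R U :=
    Module.length_eq_add_of_exact _ q (Submodule.subtype_injective _) hq q.exact_subtype_ker_map
  have : IsNoetherian R U := isNoetherian_of_surjective p (LinearMap.range_eq_top.2 hp)
  have : IsArtinian R U := isArtinian_of_surjective P p hp
  exact ENat.add_left_injective_of_ne_top Module.length_ne_top
    ((length_P hp).symm.trans (length_P ht))

theorem eq_of_covBy_ker_of_lt_ker [IsNoetherian R P] [IsArtinian R P] {p t : P →ₗ[R] U}
    (hp : Function.Surjective p) (ht : Function.Surjective t) {X Y : Submodule R P}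
    (hX : X ⋖ LinearMap.ker p) (hXY : X ≤ Y) (hY : Y < LinearMap.ker t) : X = Y := by
  by_contra hne
  have hlength : Module.length R X + 1 < Module.length R X + 1 := by
    calc Module.length R X + 1
        ≤ Module.length R Y := Order.add_one_le_of_lt <| by
          simpa only [Module.length_submodule] using
            Submodule.height_strictMono (lt_of_le_of_ne hXY hne)
      _ < Module.length R (LinearMap.ker t) := by
          simpa only [Module.length_submodule] using Submodule.height_strictMono hY
      _ = Module.length R X + 1 := by
          rw [← length_ker_eq_length_ker hp ht, length_eq_length_add_one_of_covBy hX]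
  exact hlength.false

end Length

section RightAlmostSplit

variable {R P B U : Type u} [Ring R] [AddCommGroup P] [Module R P] [AddCommGroup B] [Module R B]
  [AddCommGroup U] [Module R U] {g : B →ₗ[R] U}

theorem IsRightAlmostSplit.not_ker_le_ker {M : Type*} [AddCommGroup M] [Module R M]
    (hg : IsRightAlmostSplit g) {q : M →ₗ[R] B}
    (hq : Function.Surjective (g ∘ₗ q)) : ¬ LinearMap.ker (g ∘ₗ q) ≤ LinearMap.ker q := by
  intro h
  obtain ⟨s, hs⟩ := exists_comp_eq_of_ker_le_ker hq h
  refine hg.1 ⟨s, (LinearMap.cancel_right hq).1 ?_⟩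
  rw [LinearMap.comp_assoc, hs, LinearMap.id_comp]

theorem IsRightAlmostSplit.nontrivial (hg : IsRightAlmostSplit g) : Nontrivial U := by
  by_contra hU
  rw [not_nontrivial_iff_subsingleton] at hU
  exact hg.1 ⟨0, Subsingleton.elim _ _⟩

theorem IsRightAlmostSplit.exists_comp_eq_of_lt_ker [Module.Finite R P]
    (hg : IsRightAlmostSplit g) (hP : IsHollowModule R P) {p : P →ₗ[R] U} {X : Submodule R P}
    (hX : X < LinearMap.ker p) : ∃ k : P →ₗ[R] B, g ∘ₗ k = p ∧ X ≤ LinearMap.ker k := by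
  have := hg.nontrivial
  obtain ⟨k, hk⟩ := hg.2 (P ⧸ X) (X.liftQ p hX.le) <| by
    rintro ⟨s, hs⟩
    have injective_liftQ := (hP.of_surjective X.mkQ_surjective).injective_of_comp_eq_id hs
    refine hX.not_ge fun x hx => (Submodule.Quotient.mk_eq_zero X).1 (injective_liftQ ?_)
    rw [X.liftQ_apply, LinearMap.mem_ker.1 hx, map_zero]
  refine ⟨k ∘ₗ X.mkQ, by rw [← LinearMap.comp_assoc, hk, Submodule.liftQ_mkQ], fun x hx => ?_⟩
  rw [LinearMap.mem_ker, LinearMap.comp_apply, X.mkQ_apply, (Submodule.Quotient.mk_eq_zero X).2 hx,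
    map_zero]

/- Lift `p` to `k : P → B` killing `X`. As the submodules of `U` form a chain, some component of `k`
still maps onto `U`; its kernel contains `X` and cannot be larger, for length reasons. -/
theorem IsRightAlmostSplit.exists_ker_eq_range_le [IsNoetherian R P]
    [IsArtinian R P] {ι : Type*} [Finite ι] [DecidableEq ι] {N : ι → Submodule R B}
    (hg : IsRightAlmostSplit g) (hP : IsHollowModule R P) (hU : IsChainModule R U)
    (hN : DirectSum.IsInternal N) {p : P →ₗ[R] U} (hp : Function.Surjective p)
    {X : Submodule R P} (hX : X ⋖ LinearMap.ker p) :
    ∃ (i : ι) (q : P →ₗ[R] B), LinearMap.ker q = X ∧ LinearMap.range q ≤ N i := by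
  have := hg.nontrivial
  have := Fintype.ofFinite ι
  obtain ⟨k, rfl, hk⟩ := hg.exists_comp_eq_of_lt_ker hP hX.lt
  obtain ⟨π, hπN, hπ⟩ := exists_end_range_le_sum_eq_id hN
  obtain ⟨i, hi⟩ := hU.exists_surjective_of_sum (t := fun i => g ∘ₗ π i ∘ₗ k) <| by
    have hsum : ∑ i, g ∘ₗ π i ∘ₗ k = g ∘ₗ (∑ i, π i) ∘ₗ k := by
      ext x; simp only [LinearMap.sum_apply, LinearMap.comp_apply, map_sum]
    rwa [hsum, hπ, LinearMap.id_comp]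
  refine ⟨i, π i ∘ₗ k, (eq_of_covBy_ker_of_lt_ker hp hi hX ?_ ?_).symm,
    (LinearMap.range_comp_le_range _ _).trans (hπN i)⟩
  · exact hk.trans (LinearMap.ker_le_ker_comp k (π i))
  · exact lt_of_le_not_ge (LinearMap.ker_le_ker_comp _ g) (hg.not_ker_le_ker hi)

end RightAlmostSplit

section AlmostSplitSequences

variable {R A B U P : Type u} {S : Type*} [Ring R] [AddCommGroup A] [Module R A] [AddCommGroup B]
  [Module R B] [AddCommGroup U] [Module R U] [AddCommGroup P] [Module R P] [AddCommGroup S]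
  [Module R S] {f : A →ₗ[R] B} {g : B →ₗ[R] U}

theorem IsLeftAlmostSplit.exists_comp_eq_mkQ [Module.Finite R A] (hf : IsLeftAlmostSplit f)
    {j : S →ₗ[R] A} (hj : j ≠ 0) :
    ∃ k : B →ₗ[R] A ⧸ LinearMap.range j, k ∘ₗ f = (LinearMap.range j).mkQ := by
  refine hf.2 _ _ ?_
  rintro ⟨r, hr⟩
  have injective_mkQ : Function.Injective (LinearMap.range j).mkQ :=
    Function.LeftInverse.injective (LinearMap.congr_fun hr)
  refine hj (LinearMap.range_eq_bot.1 ?_)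
  rw [← (LinearMap.range j).ker_mkQ, LinearMap.ker_eq_bot.2 injective_mkQ]

variable [IsSimpleModule R S]

/- `θ` represents the class of the sequence in `Ext¹(U, A) = Hom(ker p, A) / Hom(P, A)`: the class
is nonzero, but its image in `Ext¹(U, A ⧸ S)` vanishes for every simple `S ≤ A`. -/
theorem IsAlmostSplitSequence.exists_ker_linearMap [Module.Projective R P] [Module.Finite R A]
    (h : IsAlmostSplitSequence f g) {p : P →ₗ[R] U} (hp : Function.Surjective p) :
    ∃ θ : LinearMap.ker p →ₗ[R] A,
      (¬ ∃ ρ : P →ₗ[R] A, ρ ∘ₗ (LinearMap.ker p).subtype = θ) ∧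
      ∀ j : S →ₗ[R] A, j ≠ 0 → ∃ ξ : LinearMap.ker p →ₗ[R] S, ∃ ρ : P →ₗ[R] A,
        ρ ∘ₗ (LinearMap.ker p).subtype = θ - j ∘ₗ ξ := by
  obtain ⟨β, hβ⟩ := Module.projective_lifting_property g p h.surjective
  have hgβ (x : P) : g (β x) = p x := LinearMap.congr_fun hβ x
  have hgf (a : A) : g (f a) = 0 := h.exact.apply_apply_eq_zero a
  obtain ⟨θ, hθ⟩ : ∃ θ, f ∘ₗ θ = β ∘ₗ (LinearMap.ker p).subtype := by
    refine exists_comp_eq_of_range_le_range h.injective ?_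
    rintro _ ⟨x, rfl⟩
    exact (h.exact _).1 ((hgβ x).trans x.2)
  have hfθ (x : LinearMap.ker p) : f (θ x) = β x := LinearMap.congr_fun hθ x
  refine ⟨θ, ?_, fun j hj => ?_⟩
  · rintro ⟨ρ, rfl⟩
    have hg : g ∘ₗ (β - f ∘ₗ ρ) = p := LinearMap.ext fun x => by
      rw [LinearMap.comp_apply, LinearMap.sub_apply, map_sub, hgβ, LinearMap.comp_apply, hgf,
        sub_zero]
    refine h.right_almost_split.not_ker_le_ker (hg ▸ hp) (hg ▸ fun x hx => ?_)
    exact sub_eq_zero.2 (hfθ ⟨x, hx⟩).symm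
  · obtain ⟨k, hk⟩ := h.left_almost_split.exists_comp_eq_mkQ hj
    obtain ⟨ρ, hρ⟩ := Module.projective_lifting_property (LinearMap.range j).mkQ (k ∘ₗ β)
      (Submodule.mkQ_surjective _)
    obtain ⟨ξ, hξ⟩ : ∃ ξ, j ∘ₗ ξ = θ - ρ ∘ₗ (LinearMap.ker p).subtype := by
      refine exists_comp_eq_of_range_le_range (LinearMap.injective_of_ne_zero hj) ?_
      rintro _ ⟨x, rfl⟩
      rw [← Submodule.ker_mkQ (LinearMap.range j), LinearMap.mem_ker, LinearMap.sub_apply, map_sub]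
      have hmkQ : (LinearMap.range j).mkQ (ρ x) = k (β x) := LinearMap.congr_fun hρ x
      rw [← hk, LinearMap.comp_apply, hfθ, hk, LinearMap.comp_apply, Submodule.subtype_apply, hmkQ,
        sub_self]
    exact ⟨ξ, ρ, by rw [hξ, sub_sub_cancel]⟩

variable (K : Type*) [Field K] [Algebra K R] [Module K A] [IsScalarTower K R A] [Module.Finite K A]
  [Module K S] [IsScalarTower K R S] [Module.Finite K S]
  [Module K P] [IsScalarTower K R P] [Module.Finite K P] [Module.Projective R P] {p : P →ₗ[R] U}

theorem IsAlmostSplitSequence.finrank_hom_left_le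
    (h : IsAlmostSplitSequence f g) (hp : Function.Surjective p) :
    Module.finrank K (S →ₗ[R] A) ≤ Module.finrank K (LinearMap.ker p →ₗ[R] S) := by
  have : Module.Finite R A := Module.Finite.of_restrictScalars_finite K R A
  obtain ⟨θ, hθ, hξ⟩ := h.exists_ker_linearMap (S := S) hp
  let comp : (S →ₗ[R] A) →ₗ[K] (LinearMap.ker p →ₗ[R] S) →ₗ[K] (LinearMap.ker p →ₗ[R] A) :=
    LinearMap.mk₂ K (fun j ξ => j ∘ₗ ξ) (fun _ _ _ => LinearMap.add_comp _ _ _)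
      (fun _ _ _ => rfl) (fun _ _ _ => LinearMap.comp_add _ _ _)
      fun c j ξ => LinearMap.ext fun x => map_smul (j.restrictScalars K) c (ξ x)
  exact finrank_le_finrank_of_forall_exists_sub_mem comp
    (E := LinearMap.range (LinearMap.lcomp K A (LinearMap.ker p).subtype)) hθ hξ

variable [Module K B] [IsScalarTower K R B]

theorem IsAlmostSplitSequence.finrank_hom_middle_le_of_isSimpleModule [IsSimpleModule R U]
    (h : IsAlmostSplitSequence f g) (hp : Function.Surjective p) :
    Module.finrank K (S →ₗ[R] B) ≤ Module.finrank K (LinearMap.ker p →ₗ[R] S) := by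
  have comp_eq_zero (q : S →ₗ[R] B) : g ∘ₗ q = 0 := by_contra fun hq => by
    have hbij := LinearMap.bijective_of_ne_zero hq
    exact h.right_almost_split.not_ker_le_ker hbij.2
      ((LinearMap.ker_eq_bot.2 hbij.1).le.trans bot_le)
  refine le_trans ?_ (h.finrank_hom_left_le K hp)
  refine LinearMap.finrank_le_finrank_of_surjective (f := LinearMap.compRight K f) fun q => ?_
  refine exists_comp_eq_of_range_le_range h.injective ?_
  rintro _ ⟨s, rfl⟩
  exact (h.exact _).1 (LinearMap.congr_fun (comp_eq_zero q) s)

variable [Module.Finite K B]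

theorem IsAlmostSplitSequence.finrank_hom_middle_le [Module K U] [IsScalarTower K R U]
    [Module.Finite K U] (h : IsAlmostSplitSequence f g) (hp : Function.Surjective p) :
    Module.finrank K (S →ₗ[R] B) ≤
      Module.finrank K (LinearMap.ker p →ₗ[R] S) + Module.finrank K (S →ₗ[R] U) :=
  (finrank_hom_le_add_of_exact_of_injective K h.injective h.exact).trans
    (Nat.add_le_add_right (h.finrank_hom_left_le K hp) _)

include K

variable {κ : Type*} [Fintype κ] {N : κ → Submodule R B}

theorem IsAlmostSplitSequence.card_le_of_isSimpleModule {ι : Type*} [Fintype ι] [IsSimpleModule R U]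
    (h : IsAlmostSplitSequence f g) (hp : Function.Surjective p) {W : ι → Submodule R P}
    (hW : ∀ i, IsHollowModule R (W i)) (hWp : ⨆ i, W i = LinearMap.ker p) (hN : iSupIndep N)
    (hN0 : ∀ k, N k ≠ ⊥) : Fintype.card κ ≤ Fintype.card ι := by
  refine card_le_card_add_card_of_ne_bot K (Y := fun _ : Empty => B) hN hN0 hW (by rintro ⟨⟩)
    fun S _ => ?_
  rw [Finset.univ_eq_empty (α := Empty), Finset.sum_empty, add_zero]
  exact (h.finrank_hom_middle_le_of_isSimpleModule K hp).trans
    (hWp ▸ finrank_hom_iSup_le_sum K W)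

variable [Module K U] [IsScalarTower K R U] [Module.Finite K U]

theorem IsAlmostSplitSequence.card_le_two (h : IsAlmostSplitSequence f g)
    (hp : Function.Surjective p) (hker : IsHollowModule R (LinearMap.ker p))
    (hU : IsChainModule R U) (hN : iSupIndep N) (hN0 : ∀ k, N k ≠ ⊥) : Fintype.card κ ≤ 2 := by
  refine card_le_card_add_card_of_ne_bot K (X := fun _ : Unit => LinearMap.ker p)
    (Y := fun _ : Unit => U) hN hN0 (fun _ => hker) (fun _ => hU) fun S _ => ?_
  simpa only [Fintype.sum_unique] using h.finrank_hom_middle_le K hp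

theorem IsAlmostSplitSequence.card_le_card_add_one {ι : Type*} [Fintype ι]
    (h : IsAlmostSplitSequence f g) (hp : Function.Surjective p) {W : ι → Submodule R P}
    (hW : ∀ i, IsChainModule R (W i)) {i₀ : ι} (hi₀ : LinearMap.ker p ⊔ W i₀ = ⨆ i, W i)
    (hU : IsChainModule R U) (hN : iSupIndep N) (hN0 : ∀ k, N k ≠ ⊥) :
    Fintype.card κ ≤ Fintype.card ι + 1 := by
  classical
  have hle : Function.update W i₀ (LinearMap.ker p ⊓ W i₀) ≤ W := update_le_self_iff.2 inf_le_right
  refine card_le_card_add_card_of_ne_bot K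
    (X := fun i => Function.update W i₀ (LinearMap.ker p ⊓ W i₀) i) (Y := fun _ : Unit => U) hN hN0
    (fun i => ((hW i).of_le (hle i)).isHollowModule) (fun _ => hU) fun S _ => ?_
  rw [Fintype.sum_unique fun _ : Unit => _]
  exact (h.finrank_hom_middle_le K hp).trans
    (Nat.add_le_add_right (finrank_hom_le_sum_update_of_sup_eq_iSup K hi₀) _)

theorem IsAlmostSplitSequence.card_le_of_not_le {ι : Type*} [Fintype ι] [DecidableEq κ]
    (h : IsAlmostSplitSequence f g) (hP : IsHollowModule R P) (hp : Function.Surjective p)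
    {W : ι → Submodule R P} (hW : ∀ i, IsChainModule R (W i)) {i₀ : ι}
    (hi₀ : LinearMap.ker p ⊔ W i₀ = ⨆ i, W i) (hker : ¬ LinearMap.ker p ≤ W i₀)
    (hWi₀ : ¬ W i₀ ≤ LinearMap.ker p) (hU : IsChainModule R U) (hN : DirectSum.IsInternal N)
    (hN0 : ∀ k, N k ≠ ⊥) : Fintype.card κ ≤ Fintype.card ι := by
  have : IsNoetherian R P := isNoetherian_of_tower K inferInstance
  have : IsArtinian R P := isArtinian_of_tower K inferInstance
  obtain ⟨X, hinf, hX⟩ := exists_le_covBy_of_lt (inf_lt_left.2 hker)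
  obtain ⟨k, q, hq, hqN⟩ := h.right_almost_split.exists_ker_eq_range_le hP hU hN hp hX
  have map_le (Y : Submodule R P) : Y.map q ≤ N k := LinearMap.map_le_range.trans hqN
  have map_ne_bot {Y : Submodule R P} (hY : ¬ Y ≤ X) : Y.map q ≠ ⊥ := fun h0 =>
    hY (hq ▸ LinearMap.le_ker_iff_map.2 h0)
  have disjoint_map : Disjoint ((LinearMap.ker p).map q) ((W i₀).map q) := by
    rw [Submodule.disjoint_def]
    rintro _ ⟨v, hv, rfl⟩ ⟨w, hw, hwv⟩
    have hwvX : w - v ∈ X := hq ▸ LinearMap.sub_mem_ker_iff.2 hwv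
    have hwX : w ∈ X := hinf ⟨sub_add_cancel w v ▸ add_mem (hX.le hwvX) hv, hw⟩
    rw [← hwv]
    exact LinearMap.mem_ker.1 (hq ▸ hwX)
  have hcard := h.card_le_card_add_one K hp hW hi₀ hU
    (iSupIndep_option_elim_update hN.submodule_iSupIndep (map_le _) (map_le _) disjoint_map) <| by
      rintro (_ | j)
      · exact map_ne_bot hX.lt.not_ge
      · rcases eq_or_ne j k with rfl | hj
        · simpa only [Option.elim_some, Function.update_self] using
            map_ne_bot fun hle => hWi₀ (hle.trans hX.le)
        · simpa only [Option.elim_some, Function.update_of_ne hj] using hN0 j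
  rw [Fintype.card_option] at hcard
  exact Nat.le_of_succ_le_succ hcard

theorem IsAlmostSplitSequence.card_le_card {ι : Type*} [Fintype ι] [DecidableEq κ]
    (h : IsAlmostSplitSequence f g) (hP : IsHollowModule R P) (hp : Function.Surjective p)
    (hU : IsChainModule R U) (hι : 2 ≤ Fintype.card ι) {W : ι → Submodule R P}
    (hW : ∀ i, IsChainModule R (W i)) (hWc : IsCoatom (⨆ i, W i)) (hN : DirectSum.IsInternal N)
    (hN0 : ∀ k, N k ≠ ⊥) : Fintype.card κ ≤ Fintype.card ι := by
  have : Nonempty ι := Fintype.card_pos_iff.1 (zero_lt_two.trans_le hι)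
  have := h.right_almost_split.nontrivial
  have ker_ne_top : LinearMap.ker p ≠ ⊤ := fun htop => by
    obtain rfl := LinearMap.ker_eq_top.1 htop
    exact bot_ne_top (LinearMap.range_zero.symm.trans (LinearMap.range_eq_top.2 hp))
  obtain ⟨i₀, hi₀⟩ := hU.exists_forall_le fun i => (W i).map p
  have hsup : LinearMap.ker p ⊔ W i₀ = ⨆ i, W i :=
    le_antisymm (sup_le (hP.le_of_isCoatom hWc ker_ne_top) (le_iSup W i₀)) <| by
      rw [sup_comm, ← Submodule.comap_map_eq]
      exact iSup_le fun i => Submodule.map_le_iff_le_comap.1 (hi₀ i)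
  by_cases hker : LinearMap.ker p ≤ W i₀
  · exact (h.card_le_two K hp ((hW i₀).of_le hker).isHollowModule hU hN.submodule_iSupIndep
      hN0).trans hι
  by_cases hWi₀ : W i₀ ≤ LinearMap.ker p
  · rw [sup_eq_left.2 hWi₀] at hsup
    have : IsSimpleModule R (P ⧸ LinearMap.ker p) := isSimpleModule_iff_isCoatom.2 (hsup ▸ hWc)
    have : IsSimpleModule R U := .congr (p.quotKerEquivOfSurjective hp).symm
    exact h.card_le_of_isSimpleModule K hp (fun i => (hW i).isHollowModule) hsup.symm
      hN.submodule_iSupIndep hN0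
  · exact h.card_le_of_not_le K hP hp hW hsup hker hWi₀ hU hN hN0

end AlmostSplitSequences

theorem mainTheorem1_general {K : Type*} {Λ : Type u} [Field K] [Ring Λ] [Algebra K Λ]
    [FiniteDimensional K Λ] (m : ℕ) (hm : 2 ≤ m) (hΛ : IsLeftMultiserial m Λ)
    (U : Type u) [AddCommGroup U] [Module Λ U] [Module.Finite Λ U] (hU : IsUniserialModule Λ U)
    (A B : Type u) [AddCommGroup A] [Module Λ A] [Module.Finite Λ A]
    [AddCommGroup B] [Module Λ B] [Module.Finite Λ B]
    (f : A →ₗ[Λ] B) (g : B →ₗ[Λ] U) (hfg : IsAlmostSplitSequence f g)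
    {κ : Type*} [Fintype κ] [DecidableEq κ] (N : κ → Submodule Λ B) (hN : DirectSum.IsInternal N)
    (hN0 : ∀ k, N k ≠ ⊥) : Fintype.card κ ≤ m := by
  have : IsArtinianRing Λ := .of_finite K Λ
  have := hfg.right_almost_split.nontrivial
  let : Module K A := .compHom A (algebraMap K Λ)
  let : Module K B := .compHom B (algebraMap K Λ)
  let : Module K U := .compHom U (algebraMap K Λ)
  have : IsScalarTower K Λ A := .of_compHom K Λ A
  have : IsScalarTower K Λ B := .of_compHom K Λ B
  have : IsScalarTower K Λ U := .of_compHom K Λ U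
  have : Module.Finite K A := .trans Λ A
  have : Module.Finite K B := .trans Λ B
  have : Module.Finite K U := .trans Λ U
  have hU := hU.isChainModule
  obtain ⟨e, he, p, hp⟩ := hU.isHollowModule.exists_isPrimitiveIdempotent_surjective
  obtain ⟨W, hW, hWJ⟩ := hΛ.exists_iSup_eq_jacobson he
  have := projective_span_singleton he.2.1
  have hP := he.isIndecomposableModule_span_singleton
  have := hP.1
  have hJ := hWJ ▸ hP.isHollowModule.isCoatom_jacobson
  simpa only [Fintype.card_fin] using
    hfg.card_le_card K hP.isHollowModule hp hU (by rwa [Fintype.card_fin]) hW hJ hN hN0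

theorem mainTheorem1 {K : Type*} {Λ : Type u} [Field K] [Ring Λ] [Algebra K Λ]
    [FiniteDimensional K Λ] (m : ℕ) (hm : 2 ≤ m) (hΛ : IsLeftMultiserial m Λ)
    (U : Type u) [AddCommGroup U] [Module Λ U] [Module.Finite Λ U]
    (hU : IsUniserialModule Λ U) (hproj : ¬ Module.Projective Λ U)
    (A B : Type u) [AddCommGroup A] [Module Λ A] [Module.Finite Λ A]
    [AddCommGroup B] [Module Λ B] [Module.Finite Λ B]
    (f : A →ₗ[Λ] B) (g : B →ₗ[Λ] U) (hfg : IsAlmostSplitSequence f g)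
    (n : ℕ) (N : Fin n → Submodule Λ B) (hN : DirectSum.IsInternal N)
    (hind : ∀ i, IsIndecomposableModule Λ (N i)) :
    n ≤ m := by
  simpa using mainTheorem1_general (K := K) m hm hΛ U hU A B f g hfg N hN fun i =>
    Submodule.nontrivial_iff_ne_bot.1 (hind i).1
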